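/- Let $r>2$ and let $F_r$ be the free group with free basis $x_1,\dots,x_r$. A freely reduced word $v$ in the letters $x_1^{\pm1},\dots,x_r^{\pm1}$ is called primitivity-blocking if for no automorphism $\varphi$ of $F_r$ it is a (contiguous) subword of the cyclic reduction of $\varphi(x_1)$. Then the word $$w=x_1x_2\cdots x_{r-1}\,x_r^2\,x_{r-1}\cdots x_2\,x_1^{-1},$$ which is freely reduced of length $2r$, is primitivity-blocking, and every primitivity-blocking freely reduced word has length at least $2r$. That is, $w$ is a primitivity-blocking word of the shortest possible length. -/

import Mathlib

/-- Words in the letters `x i` and `(x i)⁻¹` are lists of pairs `(i, b)`, as in Mathlib's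
`FreeGroup`: `(i, true)` is the letter `x i`, and `(i, false)` is the letter `(x i)⁻¹`.

The word `v` is `w`-orbit-blocking, for an element `w` of the free group, if for no automorphism
`φ` it is a (contiguous) subword of the cyclic reduction of `φ w`. -/
def IsOrbitBlocking {α : Type*} [DecidableEq α] (w : FreeGroup α) (v : List (α × Bool)) : Prop :=
  ∀ φ : MulAut (FreeGroup α), ¬ v <:+: FreeGroup.reduceCyclically (φ w).toWord

/-- The word `v` over the free basis `x_1, …, x_r` of the free group of rank `r ≥ 1` is
primitivity-blocking if it is `x_1`-orbit-blocking. The basis is indexed by `Fin r`, so that the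
index of `x_1` is `0`. -/
def IsPrimitivityBlocking {r : ℕ} (hr : 0 < r) (v : List (Fin r × Bool)) : Prop :=
  IsOrbitBlocking (FreeGroup.of (⟨0, hr⟩ : Fin r)) v

/-- The word `x_1 x_2 ⋯ x_{r-1} x_r` followed by `x_r x_{r-1} ⋯ x_2` and then by `x_1⁻¹`. -/
def shortBlockingWord {r : ℕ} (hr : 0 < r) : List (Fin r × Bool) :=
  (List.finRange r).map (fun i => (i, true)) ++
    (List.finRange r).tail.reverse.map (fun i => (i, true)) ++ [((⟨0, hr⟩ : Fin r), false)]

/-! ### Stallings folding and the cut vertex lemma. -/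

section Folding

variable {ι V W : Type*}

/-! Lower bound: a word of length below 2r uses some generator x_k at most once. A word containing
x_k exactly once is primitive, and appending at most one letter makes the given word cyclically
reduced with such an x_k (`exists_infix_reduceCyclically`).

Blocking: if w occurs in a cyclically reduced primitive word, rotate that word to wC. It labels one
loop of a wedge of loops reading a basis. Folding turns the wedge into the rose, and as the rank is
minimal each fold loses exactly one edge and one vertex. Just before the fold that makes the loop
constant, every letter but one, z, leaves the loop at only one vertex (`Spanning.exists_cut`). The
letters of w link its interior vertices by a cycle of equalities, so these vertices coincide even
without the equality lost to z (`eq_of_ladder`). Away from this common vertex only x_1 and z can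
leave, so in the cyclic word wC every x_1 is preceded by z⁻¹ and every x_1⁻¹ is followed by z
(`exists_isChain_onlyTurn`). The automorphism x_1 ↦ z⁻¹x_1 sends w to z⁻¹wz, and pulling back a
conjugate of wC gives a primitive wD with D shorter than C (`exists_shorter`). Infinite descent
concludes. -/

/-- The inverse of a letter. -/
def invLetter (a : ι × Bool) : ι × Bool := (a.1, !a.2)

@[simp] theorem invLetter_invLetter (a : ι × Bool) : invLetter (invLetter a) = a := by
  simp [invLetter]

theorem invLetter_ne (a : ι × Bool) : invLetter a ≠ a := by
  rcases a with ⟨i, _ | _⟩ <;> simp [invLetter]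

theorem invLetter_eq_iff {a b : ι × Bool} : invLetter a = b ↔ a = invLetter b :=
  ⟨fun h => by rw [← h, invLetter_invLetter], fun h => by rw [h, invLetter_invLetter]⟩

/-- The labelled edge `(source, label, target)` crossed by a step from `p` to `q` that reads the
letter `a`. -/
def letterEdge (a : ι × Bool) (p q : V) : V × ι × V := if a.2 then (p, a.1, q) else (q, a.1, p)

theorem letterEdge_invLetter (a : ι × Bool) (p q : V) :
    letterEdge (invLetter a) p q = letterEdge a q p := by
  rcases a with ⟨i, _ | _⟩ <;> rfl

theorem letterEdge_inj {a : ι × Bool} {v p p' v' : V} (h : letterEdge a v p = letterEdge a v' p') :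
    v = v' ∧ p = p' := by
  rcases a with ⟨i, _ | _⟩ <;> simp_all [letterEdge]

/-- The action of a map of vertices on labelled edges. -/
def mapEdge (g : V → W) (e : V × ι × V) : W × ι × W := (g e.1, e.2.1, g e.2.2)

theorem mapEdge_letterEdge (g : V → W) (a : ι × Bool) (p q : V) :
    mapEdge g (letterEdge a p q) = letterEdge a (g p) (g q) := by
  rcases a with ⟨i, _ | _⟩ <;> rfl

/-- `Reads E L p q` says that the word `L` labels a path from `p` to `q` in the graph `E`. -/
def Reads (E : Finset (V × ι × V)) : List (ι × Bool) → V → V → Prop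
  | [], p, q => p = q
  | a :: L, p, q => ∃ s, letterEdge a p s ∈ E ∧ Reads E L s q

theorem reads_append {E : Finset (V × ι × V)} {L M : List (ι × Bool)} {p q : V} :
    Reads E (L ++ M) p q ↔ ∃ s, Reads E L p s ∧ Reads E M s q := by
  induction L generalizing p with
  | nil => simp [Reads]
  | cons a L ih =>
    simp only [List.cons_append, Reads, ih]
    exact ⟨fun ⟨s, h, t, h1, h2⟩ => ⟨t, ⟨s, h, h1⟩, h2⟩, fun ⟨t, ⟨s, h, h1⟩, h2⟩ => ⟨s, h, t, h1, h2⟩⟩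

theorem Reads.invRev {E : Finset (V × ι × V)} {L : List (ι × Bool)} {p q : V}
    (h : Reads E L p q) : Reads E (FreeGroup.invRev L) q p := by
  induction L generalizing p with
  | nil => exact h.symm
  | cons a L ih =>
    obtain ⟨s, h1, h2⟩ := h
    rw [FreeGroup.invRev_cons, reads_append]
    refine ⟨s, ih h2, p, ?_, rfl⟩
    change letterEdge (invLetter a) s p ∈ E
    rwa [letterEdge_invLetter]

theorem Reads.map [DecidableEq W] [DecidableEq ι] {E : Finset (V × ι × V)} {L : List (ι × Bool)}
    {p q : V} (g : V → W) (h : Reads E L p q) :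
    Reads (E.image (mapEdge g)) L (g p) (g q) := by
  induction L generalizing p with
  | nil => exact congrArg g h
  | cons a L ih =>
    obtain ⟨s, h1, h2⟩ := h
    exact ⟨g s, by rw [← mapEdge_letterEdge]; exact Finset.mem_image_of_mem _ h1, ih h2⟩

theorem Reads.of_path {E : Finset (V × ι × V)} {L : List (ι × Bool)} (m : ℕ → V)
    (h : ∀ k a, L[k]? = some a → letterEdge a (m k) (m (k + 1)) ∈ E) :
    Reads E L (m 0) (m L.length) := by
  induction L generalizing m with
  | nil => rfl
  | cons a L ih =>
    refine ⟨m 1, h 0 a rfl, ?_⟩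
    exact ih (fun k => m (k + 1)) fun k b hk => h (k + 1) b (by simpa using hk)

/-- A graph is folded if no two edges with the same label leave, or enter, the same vertex. -/
def Folded (E : Finset (V × ι × V)) : Prop :=
  ∀ a p q q', letterEdge a p q ∈ E → letterEdge a p q' ∈ E → q = q'

/-- In a folded graph a cancelling pair returns to the vertex where it started, so it can be deleted
from a path. -/
theorem Folded.reads_of_red {E : Finset (V × ι × V)} (hE : Folded E) {L M : List (ι × Bool)}
    {p q : V} (hLM : FreeGroup.Red L M) (h : Reads E L p q) : Reads E M p q := by
  induction hLM with
  | refl => exact h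
  | tail _ hs ih =>
    cases hs with
    | @not L₁ L₂ x b =>
      rw [reads_append] at ih ⊢
      obtain ⟨s, h1, t, h2, s', h3, h4⟩ := ih
      have h5 : letterEdge (invLetter (x, b)) t s' ∈ E := h3
      have h6 : letterEdge (invLetter (x, b)) t s ∈ E := by rwa [letterEdge_invLetter]
      obtain rfl := hE _ _ _ _ h5 h6
      exact ⟨_, h1, h4⟩

/-- A graph `E` with vertices `S` and base vertex `o` is spanning if it is connected and every
basis element of the free group is read by a loop at the base vertex. -/
structure Spanning (E : Finset (V × ι × V)) (S : Finset V) (o : V) : Prop where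
  reach : ∀ v ∈ S, ∃ L, Reads E L o v
  surj : ∀ i, ∃ L, Reads E L o o ∧ FreeGroup.mk L = FreeGroup.of i

variable {E : Finset (V × ι × V)} {S : Finset V} {o : V}

/-- The given loop reduces to the single letter x_i, and reduction preserves paths in a folded
graph. -/
theorem Spanning.loop_mem (h : Spanning E S o) (hE : Folded E) (i : ι) : (o, i, o) ∈ E := by
  classical
  obtain ⟨L, h1, h2⟩ := h.surj i
  have h3 : FreeGroup.reduce L = [(i, true)] := by
    rw [← FreeGroup.toWord_mk, h2, FreeGroup.toWord_of]
  have h4 := hE.reads_of_red (h3 ▸ FreeGroup.reduce.red) h1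
  obtain ⟨s, h5, rfl⟩ := h4
  exact h5

theorem Spanning.eq_base (h : Spanning E S o) (hE : Folded E) {L : List (ι × Bool)} {v : V}
    (hv : Reads E L o v) : v = o := by
  induction L with
  | nil => exact hv.symm
  | cons a L ih =>
    obtain ⟨s, h1, h2⟩ := hv
    have h3 : letterEdge a o o ∈ E := by
      rcases a with ⟨i, _ | _⟩ <;> exact h.loop_mem hE i
    obtain rfl := hE _ _ _ _ h1 h3
    exact ih h2

theorem Spanning.card_le_of_folded [Fintype ι] (h : Spanning E S o) (hE : Folded E) :
    S.card + Fintype.card ι ≤ E.card + 1 := by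
  classical
  have h1 : S ⊆ {o} := fun v hv => by
    obtain ⟨L, hL⟩ := h.reach v hv
    simp [h.eq_base hE hL]
  have h2 : (Finset.univ.image fun i : ι => (o, i, o)) ⊆ E := fun e he => by
    obtain ⟨i, -, rfl⟩ := Finset.mem_image.1 he
    exact h.loop_mem hE i
  have h3 := Finset.card_le_card h1
  have h4 := Finset.card_le_card h2
  rw [Finset.card_image_of_injective _ fun i j hij => by simpa using hij] at h4
  simp only [Finset.card_singleton, Finset.card_univ] at h3 h4
  omega

/-- The map that identifies the vertex `q` with `p`. -/
def mergeVertex [DecidableEq V] (p q v : V) : V := if v = q then p else v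

theorem mapEdge_merge_letterEdge [DecidableEq V] (a : ι × Bool) (v p q : V) :
    mapEdge (mergeVertex p q) (letterEdge a v p) = mapEdge (mergeVertex p q) (letterEdge a v q) := by
  simp only [mapEdge_letterEdge]
  congr 1
  simp [mergeVertex]

section Merge

variable [DecidableEq V] [DecidableEq ι] {p q : V}

theorem Spanning.merge (h : Spanning E S o) :
    Spanning (E.image (mapEdge (mergeVertex p q))) (S.erase q) (mergeVertex p q o) where
  reach v hv := by
    obtain ⟨L, hL⟩ := h.reach v (Finset.mem_of_mem_erase hv)
    refine ⟨L, ?_⟩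
    have := hL.map (mergeVertex p q)
    rwa [show mergeVertex p q v = v from if_neg (Finset.ne_of_mem_erase hv)] at this
  surj i := by
    obtain ⟨L, h1, h2⟩ := h.surj i
    exact ⟨L, h1.map _, h2⟩

theorem image_merge_eq_erase {a : ι × Bool} {v : V} (hpq : p ≠ q)
    (hp : letterEdge a v p ∈ E) :
    E.image (mapEdge (mergeVertex p q)) =
      (E.erase (letterEdge a v q)).image (mapEdge (mergeVertex p q)) := by
  refine Finset.Subset.antisymm (fun e he => ?_)
    (Finset.image_subset_image (Finset.erase_subset _ _))
  obtain ⟨e, he', rfl⟩ := Finset.mem_image.1 he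
  by_cases h : e = letterEdge a v q
  · rw [h, ← mapEdge_merge_letterEdge]
    refine Finset.mem_image_of_mem _ (Finset.mem_erase.2 ⟨fun h => hpq (letterEdge_inj h).2, hp⟩)
  · exact Finset.mem_image_of_mem _ (Finset.mem_erase.2 ⟨h, he'⟩)

theorem card_image_merge_lt {a : ι × Bool} {v : V} (hpq : p ≠ q) (hp : letterEdge a v p ∈ E)
    (hq : letterEdge a v q ∈ E) : (E.image (mapEdge (mergeVertex p q))).card + 1 ≤ E.card := by
  rw [image_merge_eq_erase hpq hp, ← Finset.card_erase_add_one hq]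
  exact Nat.succ_le_succ Finset.card_image_le

end Merge

theorem exists_of_not_folded (hE : ¬ Folded E) : ∃ a v p q, p ≠ q ∧ letterEdge a v p ∈ E ∧
    letterEdge a v q ∈ E := by
  simp only [Folded, not_forall] at hE
  obtain ⟨a, v, p, q, h1, h2, h3⟩ := hE
  exact ⟨a, v, p, q, h3, h1, h2⟩

/-- Each fold loses at least one edge and at most one vertex, and folding ends at the rose. -/
theorem Spanning.card_le [Fintype ι] (h : Spanning E S o) :
    S.card + Fintype.card ι ≤ E.card + 1 := by
  classical
  induction hn : E.card using Nat.strong_induction_on generalizing E S o with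
  | _ n ih =>
    subst hn
    by_cases hE : Folded E
    · exact h.card_le_of_folded hE
    · obtain ⟨a, v, p, q, hpq, hp, hq⟩ := exists_of_not_folded hE
      have h1 := card_image_merge_lt hpq hp hq
      have h2 := ih _ (by omega) (h.merge (p := p) (q := q)) rfl
      have h3 := Finset.pred_card_le_card_erase (s := S) (a := q)
      omega

/-- The letter `d` leaves the vertex `v` along the path with vertices `m` that reads `u`. -/
def LeavesAt (u : List (ι × Bool)) (m : ℕ → V) (d : ι × Bool) (v : V) : Prop :=
  ∃ k a, u[k]? = some a ∧ (a = d ∧ m k = v ∨ invLetter a = d ∧ m (k + 1) = v)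

theorem LeavesAt.exists_edge {u : List (ι × Bool)} {m : ℕ → V}
    (hm : ∀ k a, u[k]? = some a → letterEdge a (m k) (m (k + 1)) ∈ E) {d : ι × Bool} {v : V}
    (h : LeavesAt u m d v) : ∃ v' k l, k ≤ u.length ∧ l ≤ u.length ∧ v = m k ∧ v' = m l ∧
      letterEdge d v v' ∈ E := by
  obtain ⟨k, a, hk, ⟨rfl, rfl⟩ | ⟨rfl, rfl⟩⟩ := h
  · have := (List.getElem?_eq_some_iff.1 hk).1
    exact ⟨_, k, k + 1, by omega, by omega, rfl, rfl, hm k _ hk⟩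
  · have := (List.getElem?_eq_some_iff.1 hk).1
    exact ⟨_, k + 1, k, by omega, by omega, rfl, rfl, by
      rw [letterEdge_invLetter]; exact hm k _ hk⟩

theorem letterEdge_label {a b : ι × Bool} {v p v' p' : V}
    (h : letterEdge a v p = letterEdge b v' p') : b = a ∨ b = invLetter a := by
  rcases a with ⟨i, _ | _⟩ <;> rcases b with ⟨j, _ | _⟩ <;> simp_all [letterEdge, invLetter]

/-- The cut vertex lemma: if a non-constant path is read in a spanning graph of minimal rank, then
after identifying some vertices it is still non-constant, and each letter but at most one
leaves it at only one vertex. -/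
theorem Spanning.exists_cut [Fintype ι] (h : Spanning E S o)
    (hcard : E.card + 1 ≤ S.card + Fintype.card ι) {u : List (ι × Bool)} {γ : ℕ → V}
    (hm : ∀ k a, u[k]? = some a → letterEdge a (γ k) (γ (k + 1)) ∈ E)
    (hreach : ∀ k ≤ u.length, ∃ L, Reads E L o (γ k))
    (hne : ∃ k ≤ u.length, γ k ≠ γ 0) :
    ∃ (f : V → V) (z : ι × Bool), (∃ k ≤ u.length, f (γ k) ≠ f (γ 0)) ∧
      ∀ d v v', d ≠ z → LeavesAt u (f ∘ γ) d v → LeavesAt u (f ∘ γ) d v' → v = v' := by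
  classical
  induction hn : E.card using Nat.strong_induction_on generalizing E S o γ with
  | _ n ih =>
    subst hn
    have hE : ¬ Folded E := fun hE => by
      obtain ⟨k, hk, hk'⟩ := hne
      obtain ⟨L, hL⟩ := hreach k hk
      obtain ⟨L', hL'⟩ := hreach 0 (Nat.zero_le _)
      exact hk' ((h.eq_base hE hL).trans (h.eq_base hE hL').symm)
    obtain ⟨a, v, p, q, hpq, hp, hq⟩ := exists_of_not_folded hE
    set g := mergeVertex p q with hg
    have h1 := card_image_merge_lt hpq hp hq
    have h2 := (h.merge (p := p) (q := q)).card_le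
    have h3 := Finset.pred_card_le_card_erase (s := S) (a := q)
    by_cases hc : ∃ k ≤ u.length, g (γ k) ≠ g (γ 0)
    · obtain ⟨f, z, hf, hz⟩ := ih _ (by omega) (h.merge (p := p) (q := q)) (by omega)
        (γ := g ∘ γ)
        (fun k b hk => by
          simp only [Function.comp]
          rw [← mapEdge_letterEdge]
          exact Finset.mem_image_of_mem _ (hm k b hk))
        (fun k hk => by
          obtain ⟨L, hL⟩ := hreach k hk
          exact ⟨L, hL.map _⟩) hc rfl
      exact ⟨f ∘ g, z, hf, hz⟩
    · push Not at hc
      -- This fold collapses the path. The folded edges both leave v by a, but their far ends p and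
      -- q differ, so a⁻¹ is the exceptional letter.
      refine ⟨id, invLetter a, hne, fun d w w' hd hw hw' => ?_⟩
      obtain ⟨t, k, l, hk, hl, rfl, rfl, he⟩ := hw.exists_edge hm
      obtain ⟨t', k', l', hk', hl', rfl, rfl, he'⟩ := hw'.exists_edge hm
      change letterEdge d (γ k) (γ l) ∈ E at he
      change letterEdge d (γ k') (γ l') ∈ E at he'
      have heq : mapEdge g (letterEdge d (γ k) (γ l)) = mapEdge g (letterEdge d (γ k') (γ l')) := by
        simp only [mapEdge_letterEdge, hc _ hk, hc _ hl, hc _ hk', hc _ hl']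
      -- Minimal rank forces the fold to lose exactly one edge, so no edges other than the folded
      -- pair become equal.
      have hinj : Set.InjOn (mapEdge (ι := ι) g) (E.erase (letterEdge a v q)) := by
        rw [← Finset.card_image_iff]
        refine le_antisymm Finset.card_image_le ?_
        rw [← image_merge_eq_erase hpq hp, Finset.card_erase_of_mem hq]
        omega
      have hp' : letterEdge a v p ∈ E.erase (letterEdge a v q) :=
        Finset.mem_erase.2 ⟨fun h => hpq (letterEdge_inj h).2, hp⟩
      have key : ∀ x y x' y', letterEdge d x y ∈ E → letterEdge d x' y' ∈ E →
          mapEdge g (letterEdge d x y) = mapEdge g (letterEdge d x' y') →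
          letterEdge d x y = letterEdge a v q → x = x' := by
        intro x y x' y' h4 h5 h6 h7
        have hda : d = a := by
          rcases letterEdge_label h7 with h | h
          · exact h.symm
          · exact absurd (by rw [h, invLetter_invLetter]) hd
        subst hda
        by_cases h8 : letterEdge d x' y' = letterEdge d v q
        · rw [(letterEdge_inj h7).1, (letterEdge_inj h8).1]
        · have h9 := hinj hp' (Finset.mem_coe.2 (Finset.mem_erase.2 ⟨h8, h5⟩))
            (by rw [← h6, h7, mapEdge_merge_letterEdge])
          rw [(letterEdge_inj h7).1, (letterEdge_inj h9).1]
      by_cases h4 : letterEdge d (γ k) (γ l) = letterEdge a v q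
      · exact key _ _ _ _ he he' heq h4
      by_cases h5 : letterEdge d (γ k') (γ l') = letterEdge a v q
      · exact (key _ _ _ _ he' he heq.symm h5).symm
      exact (letterEdge_inj (hinj (Finset.mem_coe.2 (Finset.mem_erase.2 ⟨h4, he⟩))
        (Finset.mem_coe.2 (Finset.mem_erase.2 ⟨h5, he'⟩)) heq)).1

end Folding

/-! ### The wedge of loops that reads a basis. -/

section Wedge

variable {ι : Type*} (U : ι → List (ι × Bool))

/-- The vertex after `k` letters of the `j`-th loop of a wedge of loops. -/
def wedgeVertex (j : ι) (k : ℕ) : Option (Σ _ : ι, ℕ) :=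
  if k = 0 ∨ k = (U j).length then none else some ⟨j, k⟩

/-- The edges of the wedge of loops that read the words `U j`. -/
def wedgeEdges [Fintype ι] [DecidableEq ι] :
    Finset (Option (Σ _ : ι, ℕ) × ι × Option (Σ _ : ι, ℕ)) :=
  Finset.univ.image fun x : Σ j, Fin (U j).length =>
    letterEdge (U x.1)[x.2] (wedgeVertex U x.1 x.2) (wedgeVertex U x.1 (x.2 + 1))

/-- The vertices of the wedge of loops that read the words `U j`. -/
def wedgeVertices [Fintype ι] : Finset (Option (Σ _ : ι, ℕ)) :=
  Finset.insertNone (Finset.univ.sigma fun j => Finset.Ico 1 (U j).length)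

variable [Fintype ι] [DecidableEq ι]

theorem letterEdge_mem_wedgeEdges {j : ι} {k : ℕ} {a : ι × Bool} (h : (U j)[k]? = some a) :
    letterEdge a (wedgeVertex U j k) (wedgeVertex U j (k + 1)) ∈ wedgeEdges U := by
  obtain ⟨hk, rfl⟩ := List.getElem?_eq_some_iff.1 h
  exact Finset.mem_image.2 ⟨⟨j, k, hk⟩, Finset.mem_univ _, rfl⟩

/-- A loop of length n ≥ 1 has at most n edges and n - 1 vertices besides the base, so the wedge has
minimal rank. -/
theorem card_wedgeEdges_le (hU : ∀ j, U j ≠ []) :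
    (wedgeEdges U).card + 1 ≤ (wedgeVertices U).card + Fintype.card ι := by
  have h1 : (wedgeEdges U).card ≤ ∑ j, (U j).length := by
    refine Finset.card_image_le.trans ?_
    simp [Fintype.card_sigma]
  have h2 : (wedgeVertices U).card = ∑ j, ((U j).length - 1) + 1 := by
    simp [wedgeVertices]
  have h3 : ∑ j, (U j).length = ∑ j, ((U j).length - 1) + Fintype.card ι := by
    rw [Fintype.card_eq_sum_ones, ← Finset.sum_add_distrib]
    refine Finset.sum_congr rfl fun j _ => ?_
    have := List.length_pos_iff.2 (hU j)
    omega
  omega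

theorem wedge_reads_take (j : ι) {k : ℕ} (hk : k ≤ (U j).length) :
    Reads (wedgeEdges U) ((U j).take k) none (wedgeVertex U j k) := by
  have := Reads.of_path (E := wedgeEdges U) (L := (U j).take k) (wedgeVertex U j) fun l a hl =>
    letterEdge_mem_wedgeEdges U (by
      rw [List.getElem?_take] at hl
      split at hl <;> simp_all)
  rwa [List.length_take, min_eq_left hk, show wedgeVertex U j 0 = none from if_pos (Or.inl rfl)]
    at this

theorem wedge_reads (j : ι) : Reads (wedgeEdges U) (U j) none none := by
  have := wedge_reads_take U j le_rfl
  rwa [List.take_length, show wedgeVertex U j (U j).length = none from if_pos (Or.inr rfl)] at this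

theorem spanning_wedge (ψ : MulAut (FreeGroup ι)) (hψ : ∀ j, FreeGroup.mk (U j) = ψ (.of j)) :
    Spanning (wedgeEdges U) (wedgeVertices U) none where
  reach v hv := by
    rcases v with _ | ⟨j, k⟩
    · exact ⟨[], rfl⟩
    · simp only [wedgeVertices, Finset.some_mem_insertNone, Finset.mem_sigma, Finset.mem_univ,
        true_and, Finset.mem_Ico] at hv
      have := wedge_reads_take U j hv.2.le
      rw [wedgeVertex, if_neg (by omega)] at this
      exact ⟨_, this⟩
  surj i := by
    have key : ∀ x, ∃ L, Reads (wedgeEdges U) L none none ∧ FreeGroup.mk L = ψ x := by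
      intro x
      induction x using FreeGroup.induction_on with
      | C1 => exact ⟨[], rfl, by rw [← FreeGroup.one_eq_mk, map_one]⟩
      | of j => exact ⟨U j, wedge_reads U j, hψ j⟩
      | inv_of j _ => exact ⟨_, (wedge_reads U j).invRev, by
          rw [← FreeGroup.inv_mk, hψ, map_inv]⟩
      | mul x y hx hy =>
        obtain ⟨L, h1, h2⟩ := hx
        obtain ⟨M, h3, h4⟩ := hy
        exact ⟨L ++ M, reads_append.2 ⟨_, h1, h3⟩, by rw [← FreeGroup.mul_mk, h2, h4, map_mul]⟩
    simpa using key (ψ⁻¹ (.of i))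

/-- The cut vertex lemma for a word of length at least two that belongs to a basis. -/
theorem exists_cut_of_basis (ψ : MulAut (FreeGroup ι)) {i : ι} {u : List (ι × Bool)}
    (hu : FreeGroup.mk u = ψ (.of i)) (hlen : 2 ≤ u.length) :
    ∃ (m : ℕ → Option (Σ _ : ι, ℕ)) (z : ι × Bool), m u.length = m 0 ∧
      (∃ k ≤ u.length, m k ≠ m 0) ∧
      ∀ d v v', d ≠ z → LeavesAt u m d v → LeavesAt u m d v' → v = v' := by
  let U : ι → List (ι × Bool) := fun j => if j = i then u else (ψ (.of j)).toWord
  have hUi : U i = u := if_pos rfl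
  have hU : ∀ j, FreeGroup.mk (U j) = ψ (.of j) := fun j => by
    by_cases h : j = i
    · rw [h, hUi, hu]
    · exact (congrArg _ (if_neg h)).trans FreeGroup.mk_toWord
  have hU' : ∀ j, U j ≠ [] := fun j h => by
    have := hU j
    rw [h, ← FreeGroup.one_eq_mk, eq_comm, map_eq_one_iff ψ ψ.injective] at this
    exact FreeGroup.of_ne_one j this
  obtain ⟨f, z, hf, hz⟩ := (spanning_wedge U ψ hU).exists_cut (card_wedgeEdges_le U hU')
    (u := u) (γ := wedgeVertex U i)
    (fun k a hk => letterEdge_mem_wedgeEdges U (by rwa [hUi]))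
    (fun k hk => ⟨_, wedge_reads_take U i (by rwa [hUi])⟩)
    -- As u has at least two letters, the vertex after the first one is not the base.
    ⟨1, by omega, by
      rw [wedgeVertex, wedgeVertex, if_neg (by rw [hUi]; omega), if_pos (Or.inl rfl)]
      exact Option.some_ne_none _⟩
  refine ⟨f ∘ wedgeVertex U i, z, ?_, hf, hz⟩
  simp [wedgeVertex, hUi]

end Wedge

open FreeGroup in
theorem FreeGroup.IsCyclicallyReduced.reduceCyclically_eq {ι : Type*} [DecidableEq ι]
    {L : List (ι × Bool)} (h : IsCyclicallyReduced L) : reduceCyclically L = L := by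
  induction L using List.bidirectionalRec with
  | nil => simp
  | singleton a => simp
  | cons_append a l b =>
    rw [← List.cons_append, isCyclicallyReduced_cons_append_iff] at h
    rw [reduceCyclically.cons_append, if_neg, List.cons_append]
    rintro ⟨h1, h2⟩
    have := h.2 h1
    rw [← h2] at this
    simp at this

/-! ### Transvections, and the lower bound on the length. -/

section Automorphisms

variable {ι : Type*} [DecidableEq ι]

/-- The endomorphism that multiplies the generator `i` by `a` on the left and by `b` on the right,
and fixes the other generators. -/
def transvectionHom (i : ι) (a b : FreeGroup ι) : FreeGroup ι →* FreeGroup ι :=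
  FreeGroup.lift fun j => if j = i then a * .of i * b else .of j

theorem transvectionHom_of_self (i : ι) (a b : FreeGroup ι) :
    transvectionHom i a b (.of i) = a * .of i * b := by
  simp [transvectionHom]

theorem transvectionHom_of_ne {i j : ι} (h : j ≠ i) (a b : FreeGroup ι) :
    transvectionHom i a b (.of j) = .of j := by
  simp [transvectionHom, h]

theorem transvectionHom_mk {i : ι} {L : List (ι × Bool)} (hL : ∀ x ∈ L, x.1 ≠ i)
    (a b : FreeGroup ι) : transvectionHom i a b (.mk L) = .mk L := by
  have h : ∀ x ∈ L, (cond x.2 (if x.1 = i then a * .of i * b else .of x.1)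
      (if x.1 = i then a * .of i * b else .of x.1)⁻¹ : FreeGroup ι) =
      cond x.2 (.of x.1) (.of x.1)⁻¹ := fun x hx => by rw [if_neg (hL x hx)]
  rw [transvectionHom, FreeGroup.lift_mk, List.map_congr_left h, ← FreeGroup.lift_mk,
    FreeGroup.lift_of_apply]

theorem transvectionHom_comp {i : ι} {A B : List (ι × Bool)} (hA : ∀ x ∈ A, x.1 ≠ i)
    (hB : ∀ x ∈ B, x.1 ≠ i) :
    (transvectionHom i (.mk A) (.mk B)).comp (transvectionHom i (.mk A)⁻¹ (.mk B)⁻¹) =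
      MonoidHom.id _ := by
  refine FreeGroup.ext_hom _ _ fun j => ?_
  by_cases h : j = i
  · subst h
    simp only [MonoidHom.comp_apply, transvectionHom_of_self, map_mul, map_inv,
      transvectionHom_mk hA, transvectionHom_mk hB, MonoidHom.id_apply]
    group
  · simp [transvectionHom_of_ne h]

theorem exists_transvection {i : ι} {A B : List (ι × Bool)} (hA : ∀ x ∈ A, x.1 ≠ i)
    (hB : ∀ x ∈ B, x.1 ≠ i) :
    ∃ φ : MulAut (FreeGroup ι), ∀ x, φ x = transvectionHom i (.mk A) (.mk B) x := by
  have hinv : ∀ {L : List (ι × Bool)}, (∀ x ∈ L, x.1 ≠ i) →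
      ∀ x ∈ FreeGroup.invRev L, x.1 ≠ i := fun h x hx => by
    simp only [FreeGroup.invRev, List.mem_reverse, List.mem_map] at hx
    obtain ⟨y, hy, rfl⟩ := hx
    exact h y hy
  have h := transvectionHom_comp (hinv hA) (hinv hB)
  rw [← FreeGroup.inv_mk, ← FreeGroup.inv_mk, inv_inv, inv_inv] at h
  exact ⟨MonoidHom.toMulEquiv _ _ h (transvectionHom_comp hA hB), fun _ => rfl⟩

theorem exists_inversion (i : ι) : ∃ φ : MulAut (FreeGroup ι), φ (.of i) = (.of i)⁻¹ := by
  let f : FreeGroup ι →* FreeGroup ι :=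
    FreeGroup.lift fun j => if j = i then (.of i)⁻¹ else .of j
  have h : f.comp f = MonoidHom.id _ := by
    refine FreeGroup.ext_hom _ _ fun j => ?_
    by_cases h : j = i <;> simp [f, h]
  exact ⟨MonoidHom.toMulEquiv f f h h, by simp [f]⟩

/-- An element that is the product of a letter `x k` or `(x k)⁻¹` and of elements that do not
involve `x k` belongs to a basis. -/
theorem exists_mulAut_eq_mk (i k : ι) (b : Bool) {A B : List (ι × Bool)}
    (hA : ∀ x ∈ A, x.1 ≠ k) (hB : ∀ x ∈ B, x.1 ≠ k) :
    ∃ φ : MulAut (FreeGroup ι), φ (.of i) = .mk (A ++ (k, b) :: B) := by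
  obtain ⟨φ, hφ⟩ := exists_transvection hA hB
  let σ : MulAut (FreeGroup ι) := FreeGroup.freeGroupCongr (Equiv.swap i k)
  have hσ : σ (.of i) = .of k := by simp [σ]
  have hmk : ∀ c, FreeGroup.mk (A ++ (k, c) :: B) = .mk A * .mk [(k, c)] * .mk B := by
    simp
  cases b with
  | true =>
    refine ⟨φ * σ, ?_⟩
    rw [MulAut.mul_apply, hσ, hφ, transvectionHom_of_self, hmk]
    rfl
  | false =>
    obtain ⟨ν, hν⟩ := exists_inversion k
    have hinv : ∀ {L : List (ι × Bool)}, (∀ x ∈ L, x.1 ≠ k) →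
        ∀ x ∈ FreeGroup.invRev L, x.1 ≠ k := fun h x hx => by
      simp only [FreeGroup.invRev, List.mem_reverse, List.mem_map] at hx
      obtain ⟨y, hy, rfl⟩ := hx
      exact h y hy
    -- A x_k⁻¹ B is the inverse of B⁻¹ x_k A⁻¹, so the two sides are exchanged.
    obtain ⟨φ, hφ⟩ := exists_transvection (hinv hB) (hinv hA)
    refine ⟨φ * ν * σ, ?_⟩
    rw [MulAut.mul_apply, hσ, MulAut.mul_apply, hν, map_inv, hφ, transvectionHom_of_self, hmk,
      ← FreeGroup.inv_mk, ← FreeGroup.inv_mk]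
    simp only [mul_inv_rev, inv_inv, mul_assoc]
    rfl

theorem exists_reduceCyclically_eq (i k : ι) (b : Bool) {A B : List (ι × Bool)}
    (hA : ∀ x ∈ A, x.1 ≠ k) (hB : ∀ x ∈ B, x.1 ≠ k)
    (h : FreeGroup.IsCyclicallyReduced (A ++ (k, b) :: B)) :
    ∃ φ : MulAut (FreeGroup ι),
      FreeGroup.reduceCyclically (φ (.of i)).toWord = A ++ (k, b) :: B := by
  obtain ⟨φ, hφ⟩ := exists_mulAut_eq_mk i k b hA hB
  exact ⟨φ, by rw [hφ, FreeGroup.toWord_mk, h.1.reduce_eq, h.reduceCyclically_eq]⟩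

omit [DecidableEq ι] in
theorem isCyclicallyReduced_concat {v : List (ι × Bool)} (hv : FreeGroup.IsReduced v)
    {a : ι × Bool} (hlast : ∀ x ∈ v.getLast?, x.1 ≠ a.1) (hhead : ∀ x ∈ v.head?, x.1 ≠ a.1) :
    FreeGroup.IsCyclicallyReduced (v ++ [a]) := by
  refine ⟨List.IsChain.append hv (List.isChain_singleton a) fun x hx y hy h => ?_, ?_⟩
  · simp only [List.head?_cons, Option.mem_def, Option.some.injEq] at hy
    exact absurd (hy ▸ h) (hlast x hx)
  · intro x hx y hy h
    rw [List.getLast?_concat, Option.mem_def, Option.some.injEq] at hx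
    subst hx
    cases v with
    | nil => simp_all
    | cons c v =>
      simp only [List.cons_append, List.head?_cons, Option.mem_def, Option.some.injEq] at hy
      exact absurd (hy ▸ h).symm (hhead c rfl)

theorem exists_count_le_one [Fintype ι] (v : List (ι × Bool)) (hv : v.length < 2 * Fintype.card ι) :
    ∃ k, (v.map Prod.fst).count k ≤ 1 := by
  by_contra! h
  have h1 := Multiset.sum_count_eq_card (s := Finset.univ) (m := (↑(v.map Prod.fst) : Multiset ι))
    fun a _ => Finset.mem_univ a
  simp only [Multiset.coe_count, Multiset.coe_card, List.length_map] at h1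
  have h2 : ∑ _k : ι, 2 ≤ ∑ k, (v.map Prod.fst).count k := Finset.sum_le_sum fun k _ => h k
  simp only [Finset.sum_const, Finset.card_univ, smul_eq_mul] at h2
  omega

/-- A reduced word of length less than twice the rank is a subword of a cyclically reduced
primitive word. -/
theorem exists_infix_reduceCyclically [Fintype ι] (hr : 2 < Fintype.card ι) (i : ι)
    {v : List (ι × Bool)} (hv : FreeGroup.IsReduced v) (hlen : v.length < 2 * Fintype.card ι) :
    ∃ φ : MulAut (FreeGroup ι), v <:+: FreeGroup.reduceCyclically (φ (.of i)).toWord := by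
  obtain ⟨k, hk⟩ := exists_count_le_one v hlen
  by_cases hmem : k ∈ v.map Prod.fst
  · obtain ⟨⟨k', b⟩, hkb, rfl⟩ := List.mem_map.1 hmem
    obtain ⟨A, B, rfl⟩ := List.append_of_mem hkb
    have hAB : (A.map Prod.fst).count k' = 0 ∧ (B.map Prod.fst).count k' = 0 := by
      simp only [List.map_append, List.map_cons, List.count_append, List.count_cons_self] at hk
      omega
    have hA : ∀ x ∈ A, x.1 ≠ k' := fun x hx h =>
      List.count_eq_zero.1 hAB.1 (h ▸ List.mem_map_of_mem hx)
    have hB : ∀ x ∈ B, x.1 ≠ k' := fun x hx h =>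
      List.count_eq_zero.1 hAB.2 (h ▸ List.mem_map_of_mem hx)
    by_cases hcyc : FreeGroup.IsCyclicallyReduced (A ++ (k', b) :: B)
    · obtain ⟨φ, hφ⟩ := exists_reduceCyclically_eq i k' b hA hB hcyc
      exact ⟨φ, hφ ▸ List.infix_refl _⟩
    -- The word is reduced but not cyclically reduced, so its first and last letters involve the
    -- same generator.
    · have h1 : ∃ l, ∀ x, x ∈ (A ++ (k', b) :: B).getLast? ∨ x ∈ (A ++ (k', b) :: B).head? →
          x.1 = l := by
        by_contra! h2
        refine hcyc ⟨hv, fun x hx y hy hxy => ?_⟩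
        obtain ⟨w, hw, hw'⟩ := h2 x.1
        rcases hw with hw | hw
        · rw [Option.mem_def] at hw hx
          exact absurd (by simp_all) hw'
        · rw [Option.mem_def] at hw hy
          exact absurd (by simp_all) hw'
      obtain ⟨l, hl⟩ := h1
      -- Rank greater than two leaves a generator different from both x_k and x_l.
      obtain ⟨j, hj⟩ : ∃ j, j ∉ ({k', l} : Finset ι) := by
        by_contra! h2
        have h3 := Finset.card_le_card (fun j _ => h2 j : (Finset.univ : Finset ι) ⊆ {k', l})
        have h4 := Finset.card_le_two (a := k') (b := l)
        rw [Finset.card_univ] at h3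
        omega
      simp only [Finset.mem_insert, Finset.mem_singleton, not_or] at hj
      have h5 := isCyclicallyReduced_concat hv (a := (j, true))
        (fun x hx h => hj.2 (h.symm.trans (hl x (Or.inl hx)))) (fun x hx h => hj.2 (h.symm.trans (hl x (Or.inr hx))))
      rw [List.append_assoc, List.cons_append] at h5
      obtain ⟨φ, hφ⟩ := exists_reduceCyclically_eq i k' b hA (B := B ++ [(j, true)])
        (fun x hx => by
          rcases List.mem_append.1 hx with hx | hx
          · exact hB x hx
          · rw [List.mem_singleton.1 hx]
            exact hj.1) h5
      exact ⟨φ, hφ ▸ ⟨[], [(j, true)], by simp⟩⟩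
  · have hk' : ∀ x ∈ v, x.1 ≠ k := fun x hx h => hmem (h ▸ List.mem_map_of_mem hx)
    obtain ⟨φ, hφ⟩ := exists_reduceCyclically_eq i k true hk' (B := []) (by simp)
      (isCyclicallyReduced_concat hv (fun x hx => hk' x (List.mem_of_getLast? hx))
        (fun x hx => hk' x (List.mem_of_head? hx)))
    exact ⟨φ, hφ ▸ ⟨[], [(k, true)], by simp⟩⟩

end Automorphisms

/-! ### The substitution x_i ↦ z⁻¹x_i on words. -/

section Substitution

variable {ι : Type*} [DecidableEq ι]

/-- The word that replaces a letter when `x i` is multiplied on the left by `z⁻¹`. -/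
def leftMulBlock (i : ι) (z a : ι × Bool) : List (ι × Bool) :=
  if a = (i, true) then [invLetter z, a] else if a = (i, false) then [a, z] else [a]

theorem exists_mulAut_flatMap {i : ι} {z : ι × Bool} (hz : z.1 ≠ i) :
    ∃ φ : MulAut (FreeGroup ι), ∀ L, φ (.mk L) = .mk (L.flatMap (leftMulBlock i z)) := by
  obtain ⟨φ, hφ⟩ := exists_transvection (i := i) (A := [invLetter z]) (B := [])
    (by simpa [invLetter] using hz) (by simp)
  refine ⟨φ, fun L => ?_⟩
  induction L with
  | nil => exact map_one φ
  | cons a L ih =>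
    rw [List.flatMap_cons, ← FreeGroup.mul_mk, ← ih, ← List.singleton_append,
      ← FreeGroup.mul_mk, map_mul]
    congr 1
    have hof : φ (.mk [(i, true)]) = .mk [invLetter z, (i, true)] := by
      rw [hφ]
      exact (transvectionHom_of_self _ _ _).trans (by
        rw [← FreeGroup.one_eq_mk, mul_one]; exact FreeGroup.mul_mk)
    by_cases h1 : a = (i, true)
    · rw [leftMulBlock, if_pos h1, h1, hof]
    rw [leftMulBlock, if_neg h1]
    by_cases h2 : a = (i, false)
    · have h3 : FreeGroup.mk [(i, false)] = (FreeGroup.mk [(i, true)])⁻¹ := rfl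
      rw [if_pos h2, h2, h3, map_inv, hof, FreeGroup.inv_mk]
      simp [FreeGroup.invRev, invLetter]
    · rw [if_neg h2, hφ, transvectionHom_mk]
      rintro x hx rfl
      rw [List.mem_singleton] at hx
      rcases a with ⟨j, _ | _⟩ <;> simp_all

theorem flatMap_leftMulBlock_of_ne {i : ι} (z : ι × Bool) {L : List (ι × Bool)}
    (hL : ∀ x ∈ L, x.1 ≠ i) : L.flatMap (leftMulBlock i z) = L := by
  induction L with
  | nil => rfl
  | cons a L ih =>
    rw [List.flatMap_cons, ih fun x hx => hL x (List.mem_cons_of_mem _ hx), leftMulBlock, if_neg,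
      if_neg]
    · rfl
    all_goals
      rintro rfl
      exact hL _ List.mem_cons_self rfl

/-- A cancelling pair survives substitution: x_i x_i⁻¹ becomes z⁻¹x_i x_i⁻¹z, and x_i⁻¹x_i becomes
x_i⁻¹z z⁻¹x_i. -/
theorem isReduced_of_flatMap_leftMulBlock {i : ι} {z : ι × Bool} {L : List (ι × Bool)}
    (h : FreeGroup.IsReduced (L.flatMap (leftMulBlock i z))) : FreeGroup.IsReduced L := by
  induction L with
  | nil => exact .nil
  | cons a L ih =>
    cases L with
    | nil => exact .singleton
    | cons b L =>
      rw [FreeGroup.isReduced_cons_cons]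
      refine ⟨fun hab => ?_, ih (h.infix ⟨leftMulBlock i z a, [], by simp⟩)⟩
      have h1 : FreeGroup.IsReduced (leftMulBlock i z a ++ leftMulBlock i z b) :=
        h.infix ⟨[], L.flatMap (leftMulBlock i z), by simp⟩
      obtain ⟨j, c⟩ := a
      obtain ⟨j', c'⟩ := b
      obtain rfl : j = j' := hab
      by_cases hj : j = i
      · subst hj
        clear h ih
        cases c <;> cases c' <;> simp [leftMulBlock, FreeGroup.isReduced_cons_cons, invLetter] at h1 ⊢
      · simpa [leftMulBlock, hj, FreeGroup.isReduced_cons_cons] using h1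

/-- The consecutive letters `a`, `b` are such that `x i` is preceded by `z⁻¹` and `(x i)⁻¹` is
followed by `z`. -/
def OnlyTurn (i : ι) (z a b : ι × Bool) : Prop :=
  (invLetter a = (i, true) → b = z) ∧ (b = (i, true) → invLetter a = z)

/-- The word is cut from the left into blocks z⁻¹x_i, x_i⁻¹z and single letters. The appended z⁻¹
excludes a final x_i⁻¹, and the head condition an initial x_i, whose blocks would stick out of C. -/
theorem exists_flatMap_eq {i : ι} {z : ι × Bool} (hz : z.1 ≠ i) (C : List (ι × Bool))
    (hC : (C ++ [invLetter z]).IsChain (OnlyTurn i z)) (hhead : C.head? ≠ some (i, true)) :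
    ∃ D : List (ι × Bool), D.length ≤ C.length ∧ D.flatMap (leftMulBlock i z) = C := by
  induction hn : C.length using Nat.strong_induction_on generalizing C with
  | _ n ih =>
    subst hn
    rcases C with _ | ⟨a, C⟩
    · exact ⟨[], le_rfl, rfl⟩
    have ha : a ≠ (i, true) := fun h => hhead (by rw [h]; rfl)
    rcases C with _ | ⟨b, C⟩
    · refine ⟨[a], le_rfl, ?_⟩
      have : a ≠ (i, false) := by
        rintro rfl
        have := (List.isChain_cons_cons.1 hC).1.1 rfl
        exact invLetter_ne z this
      simp [leftMulBlock, ha, this]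
    · rw [List.cons_append, List.cons_append, List.isChain_cons_cons] at hC
      -- Blocks do not overlap: an x_i right after d requires d = z⁻¹.
      have hcons : ∀ d : ι × Bool, (d :: (C ++ [invLetter z])).IsChain (OnlyTurn i z) →
          invLetter d ≠ z → C.head? ≠ some (i, true) := fun d hd hdz h => by
        cases C with
        | nil => simp at h
        | cons c C =>
          simp only [List.head?_cons, Option.some.injEq] at h
          exact hdz ((List.isChain_cons_cons.1 hd).1.2 h)
      by_cases ha' : a = (i, false)
      · obtain rfl : b = z := hC.1.1 (by rw [ha']; rfl)
        obtain ⟨D, h1, h2⟩ := ih C.length (by simp) C hC.2.tail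
          (hcons _ hC.2 (invLetter_ne _)) rfl
        exact ⟨a :: D, by simp; omega, by simp [leftMulBlock, ha', h2]⟩
      by_cases hb : b = (i, true)
      · have hb' := invLetter_eq_iff.1 (hC.1.2 hb)
        obtain ⟨D, h1, h2⟩ := ih C.length (by simp) C hC.2.tail
          (hcons _ hC.2 (by rw [hb]; rintro rfl; exact hz rfl)) rfl
        exact ⟨b :: D, by simp; omega, by simp [leftMulBlock, hb, h2, hb']⟩
      · obtain ⟨D, h1, h2⟩ := ih (C.length + 1) (by simp) (b :: C) hC.2
          (fun h => hb (by simpa using h)) rfl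
        exact ⟨a :: D, by simpa using h1, by simp [leftMulBlock, ha, ha', h2]⟩

end Substitution
-- The blocking word and its ladder of equal vertices.
section BlockingWord

variable {r : ℕ}

theorem length_shortBlockingWord (hr : 0 < r) : (shortBlockingWord hr).length = 2 * r := by
  simp [shortBlockingWord]
  omega

theorem shortBlockingWord_getElem?_of_lt (hr : 0 < r) {j : ℕ} (hj : j < r) :
    (shortBlockingWord hr)[j]? = some (⟨j, hj⟩, true) := by
  simp [shortBlockingWord, List.getElem?_append, hj]

theorem shortBlockingWord_getElem?_sub (hr : 0 < r) {j : ℕ} (hj : j < r) (hj' : 1 ≤ j) :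
    (shortBlockingWord hr)[2 * r - 1 - j]? = some (⟨j, hj⟩, true) := by
  have h1 : ¬ 2 * r - 1 - j < r := by omega
  have h2 : 2 * r - 1 - j - r < r - 1 := by omega
  simp [shortBlockingWord, List.getElem?_append, h1, h2]
  omega

theorem shortBlockingWord_getElem?_last (hr : 0 < r) :
    (shortBlockingWord hr)[2 * r - 1]? = some (⟨0, hr⟩, false) := by
  have h1 : ¬ 2 * r - 1 < r := by omega
  have h2 : 2 * r - 1 - r = r - 1 := by omega
  simp [shortBlockingWord, List.getElem?_append, h1, h2]

theorem shortBlockingWord_eq (hr : 0 < r) : ∃ t : List (Fin r × Bool), (∀ x ∈ t, x.1 ≠ ⟨0, hr⟩) ∧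
    shortBlockingWord hr = (⟨0, hr⟩, true) :: t ++ [(⟨0, hr⟩, false)] := by
  obtain ⟨n, rfl⟩ := Nat.exists_eq_succ_of_ne_zero hr.ne'
  refine ⟨(List.finRange (n + 1)).tail.map (fun i => (i, true)) ++
    (List.finRange (n + 1)).tail.reverse.map (fun i => (i, true)), ?_, ?_⟩
  · have h : ∀ i ∈ (List.finRange (n + 1)).tail, i ≠ ⟨0, hr⟩ := by
      intro i hi
      rw [List.finRange_succ, List.tail_cons] at hi
      obtain ⟨j, -, rfl⟩ := List.mem_map.1 hi
      exact Fin.succ_ne_zero j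
    intro x hx
    simp only [List.mem_append, List.mem_map, List.mem_reverse] at hx
    obtain ⟨i, hi, rfl⟩ | ⟨i, hi, rfl⟩ := hx <;> exact h i hi
  · simp [shortBlockingWord, List.finRange_succ]

theorem isReduced_shortBlockingWord (hr : 1 < r) :
    FreeGroup.IsReduced (shortBlockingWord (r := r) (by omega)) := by
  have hr0 : 0 < r := by omega
  have htrue : ∀ k < 2 * r - 1, ∃ j, (shortBlockingWord hr0)[k]? = some (j, true) := by
    intro k hk
    by_cases h : k < r
    · exact ⟨_, shortBlockingWord_getElem?_of_lt hr0 h⟩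
    · have := shortBlockingWord_getElem?_sub hr0 (j := 2 * r - 1 - k) (by omega) (by omega)
      rw [show 2 * r - 1 - (2 * r - 1 - k) = k by omega] at this
      exact ⟨_, this⟩
  rw [FreeGroup.IsReduced, List.isChain_iff_getElem]
  intro k hk h
  have hlen := length_shortBlockingWord hr0
  by_cases hk' : k + 1 < 2 * r - 1
  · obtain ⟨j, hj⟩ := htrue k (by omega)
    obtain ⟨j', hj'⟩ := htrue (k + 1) hk'
    rw [(List.getElem?_eq_some_iff.1 hj).2, (List.getElem?_eq_some_iff.1 hj').2]
  · have h1 := shortBlockingWord_getElem?_sub hr0 (j := 1) hr le_rfl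
    have h2 := shortBlockingWord_getElem?_last hr0
    rw [show 2 * r - 1 - 1 = k by omega] at h1
    rw [show 2 * r - 1 = k + 1 by omega] at h2
    rw [(List.getElem?_eq_some_iff.1 h1).2, (List.getElem?_eq_some_iff.1 h2).2] at h
    simp at h

/-- A cycle remains connected when the relations that come from one letter are dropped. -/
theorem eq_of_ladder {V : Type*} {m : ℕ → V} {j₀ : ℕ} {b₀ : Bool} (hj₀ : j₀ < r)
    (h0 : (0, false) ≠ (j₀, b₀) → m 1 = m (2 * r - 1))
    (hpos : ∀ j, 1 ≤ j → j < r → (j, true) ≠ (j₀, b₀) → m j = m (2 * r - 1 - j))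
    (hneg : ∀ j, 1 ≤ j → j < r → (j, false) ≠ (j₀, b₀) → m (j + 1) = m (2 * r - j))
    {k : ℕ} (hk : 1 ≤ k) (hk' : k < 2 * r) : m k = m r := by
  -- `up` moves outwards from the middle vertex as far as j₀ + 1, `low` inwards from the ends as far
  -- as j₀, and `bridge` joins the two by the relation at j₀ that survives.
  have up : ∀ t, t + 1 ≤ r → j₀ < r - t → m (r - t) = m r ∧ m (r + t) = m r := by
    intro t
    induction t with
    | zero => simp
    | succ t ih =>
      intro h1 h2
      obtain ⟨h3, h4⟩ := ih (by omega) (by omega)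
      have h5 := hpos (r - (t + 1)) (by omega) (by omega) (by simp; omega)
      have h6 := hneg (r - (t + 1)) (by omega) (by omega) (by simp; omega)
      rw [show 2 * r - 1 - (r - (t + 1)) = r + t by omega] at h5
      rw [show r - (t + 1) + 1 = r - t by omega,
        show 2 * r - (r - (t + 1)) = r + (t + 1) by omega] at h6
      exact ⟨h5.trans h4, h6.symm.trans h3⟩
  have low : ∀ j, 1 ≤ j → j ≤ j₀ → m j = m 1 ∧ m (2 * r - j) = m 1 := by
    intro j hj
    induction j, hj using Nat.le_induction with
    | base => exact fun h => ⟨rfl, (h0 (by simp; omega)).symm⟩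
    | succ j hj ih =>
      intro h
      obtain ⟨h1, h2⟩ := ih (by omega)
      have h3 := hpos j hj (by omega) (by simp; omega)
      have h4 := hneg j hj (by omega) (by simp; omega)
      rw [show 2 * r - 1 - j = 2 * r - (j + 1) by omega] at h3
      exact ⟨h4.trans h2, h3.symm.trans h1⟩
  have bridge : 1 ≤ j₀ → m 1 = m r := by
    intro h
    obtain ⟨h1, h2⟩ := low j₀ h le_rfl
    obtain ⟨h3, h4⟩ := up (r - 1 - j₀) (by omega) (by omega)
    rw [show r - (r - 1 - j₀) = j₀ + 1 by omega] at h3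
    rw [show r + (r - 1 - j₀) = 2 * r - 1 - j₀ by omega] at h4
    cases b₀ with
    | true => rw [← h2, ← h3, hneg j₀ h hj₀ (by simp)]
    | false => rw [← h1, ← h4, hpos j₀ h hj₀ (by simp)]
  by_cases hkr : k ≤ r
  · by_cases hkj : j₀ < k
    · have := (up (r - k) (by omega) (by omega)).1
      rwa [show r - (r - k) = k by omega] at this
    · exact (low k hk (by omega)).1.trans (bridge (by omega))
  · by_cases hkj : j₀ < 2 * r - k
    · have := (up (k - r) (by omega) (by omega)).2
      rwa [show r + (k - r) = k by omega] at this
    · have := (low (2 * r - k) (by omega) (by omega)).2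
      rw [show 2 * r - (2 * r - k) = k by omega] at this
      exact this.trans (bridge (by omega))

/-- Excludes z = x_i⁻¹: each x_i⁻¹ would be followed by another one, and x_i would never be reached.
-/
theorem not_isChain_onlyTurn_inv {ι : Type*} (i : ι) (C : List (ι × Bool)) :
    ¬ ((i, false) :: (C ++ [(i, true)])).IsChain (OnlyTurn i (i, false)) := by
  induction C with
  | nil =>
    intro h
    have := (List.isChain_cons_cons.1 h).1.1 rfl
    simp at this
  | cons a C ih =>
    intro h
    rw [List.cons_append, List.isChain_cons_cons] at h
    rw [h.1.1 rfl] at h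
    exact ih h.2

/-! ### Descent on primitive words that contain the blocking word. -/

variable {C : List (Fin r × Bool)} (ψ : MulAut (FreeGroup (Fin r)))

/-- The extra final x_1 repeats the first letter of w, so the chain also covers the turn where the
cyclic word closes up. -/
theorem exists_isChain_onlyTurn (hr0 : 0 < r)
    (hred : FreeGroup.IsReduced (shortBlockingWord hr0 ++ C ++ shortBlockingWord hr0))
    (hψ : FreeGroup.mk (shortBlockingWord hr0 ++ C) = ψ (.of ⟨0, hr0⟩)) :
    ∃ z : Fin r × Bool, z.1 ≠ ⟨0, hr0⟩ ∧
      (shortBlockingWord hr0 ++ C ++ [((⟨0, hr0⟩ : Fin r), true)]).IsChain (OnlyTurn (⟨0, hr0⟩ : Fin r) z) := by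
  have hlen := length_shortBlockingWord hr0
  obtain ⟨t, -, ht⟩ := shortBlockingWord_eq hr0
  have hlast := shortBlockingWord_getElem?_last hr0
  have hlt := fun j (hj : j < r) => shortBlockingWord_getElem?_of_lt hr0 hj
  have hsub := fun j (hj : j < r) (hj' : 1 ≤ j) => shortBlockingWord_getElem?_sub hr0 hj hj'
  set w := shortBlockingWord hr0 with hw
  obtain ⟨m, z, hclosed, ⟨k₁, hk₁, hk₁'⟩, hz⟩ := exists_cut_of_basis ψ hψ
    (by rw [List.length_append]; omega)
  set u := w ++ C with hu
  have hulen : 2 * r ≤ u.length := by rw [hu, List.length_append]; omega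
  have hwu : ∀ k a, w[k]? = some a → u[k]? = some a := fun k a h => by
    rw [hu, List.getElem?_append_left (List.getElem?_eq_some_iff.1 h).1, h]
  have hint : ∀ k, 1 ≤ k → k < 2 * r → m k = m r := by
    intro k
    refine eq_of_ladder (j₀ := z.1) (b₀ := z.2) z.1.2 (fun h => ?_) (fun j h1 h2 h => ?_)
      (fun j h1 h2 h => ?_)
    · exact hz (⟨0, hr0⟩, false) _ _ (by rintro rfl; exact h rfl)
        ⟨0, _, hwu _ _ (hlt 0 hr0), Or.inr ⟨rfl, rfl⟩⟩ ⟨_, _, hwu _ _ hlast, Or.inl ⟨rfl, rfl⟩⟩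
    · exact hz (⟨j, h2⟩, true) _ _ (by rintro rfl; exact h rfl)
        ⟨j, _, hwu _ _ (hlt j h2), Or.inl ⟨rfl, rfl⟩⟩
        ⟨_, _, hwu _ _ (hsub j h2 h1), Or.inl ⟨rfl, rfl⟩⟩
    · exact hz (⟨j, h2⟩, false) _ _ (by rintro rfl; exact h rfl)
        ⟨j, _, hwu _ _ (hlt j h2), Or.inr ⟨rfl, rfl⟩⟩
        ⟨_, _, hwu _ _ (hsub j h2 h1), Or.inr ⟨rfl, by congr 1; omega⟩⟩
  -- Every letter except x_1 leaves some interior vertex of w, hence the common vertex `m r`; unless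
  -- it is z, it leaves no other.
  have hdir : ∀ d v, d ≠ (⟨0, hr0⟩, true) → d ≠ z → LeavesAt u m d v → v = m r := by
    rintro ⟨⟨j, hj⟩, b⟩ v hd hdz hv
    cases b with
    | true =>
      have hj0 : 1 ≤ j := by
        by_contra h
        obtain rfl : j = 0 := by omega
        exact hd rfl
      rw [← hint j hj0 (by omega)]
      exact hz _ _ _ hdz hv ⟨j, _, hwu _ _ (hlt j hj), Or.inl ⟨rfl, rfl⟩⟩
    | false =>
      rw [← hint (j + 1) (by omega) (by omega)]
      exact hz _ _ _ hdz hv ⟨j, _, hwu _ _ (hlt j hj), Or.inr ⟨rfl, rfl⟩⟩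
  have hturn : ∀ k (hk : k + 1 < (u ++ [((⟨0, hr0⟩ : Fin r), true)]).length),
      LeavesAt u m (invLetter (u ++ [((⟨0, hr0⟩ : Fin r), true)])[k]) (m (k + 1)) ∧
      LeavesAt u m (u ++ [((⟨0, hr0⟩ : Fin r), true)])[k + 1] (m (k + 1)) ∧
      invLetter (u ++ [((⟨0, hr0⟩ : Fin r), true)])[k] ≠ (u ++ [((⟨0, hr0⟩ : Fin r), true)])[k + 1] := by
    intro k hk
    have hk' : k < u.length := by simpa using hk
    refine ⟨⟨k, _, ?_, Or.inr ⟨rfl, rfl⟩⟩, ?_, ?_⟩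
    · rw [List.getElem_append_left hk', List.getElem?_eq_getElem hk']
    · by_cases h : k + 1 < u.length
      · refine ⟨k + 1, _, ?_, Or.inl ⟨rfl, rfl⟩⟩
        rw [List.getElem_append_left h, List.getElem?_eq_getElem h]
      · have h' : k + 1 = u.length := by omega
        refine ⟨0, _, hwu _ _ (hlt 0 hr0), Or.inl ⟨?_, by rw [h', hclosed]⟩⟩
        simp [h']
    · have h1 : FreeGroup.IsReduced (u ++ [((⟨0, hr0⟩ : Fin r), true)]) :=
        hred.infix ⟨[], t ++ [(⟨0, hr0⟩, false)], by simp [ht]⟩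
      have h2 := List.isChain_iff_getElem.1 h1 k hk
      intro h3
      rw [← h3] at h2
      simp [invLetter] at h2
  obtain ⟨k₂, hk₂, hk₂'⟩ : ∃ k < u.length, m (k + 1) ≠ m r := by
    by_contra! h
    have h1 : ∀ k ≤ u.length, m k = m r := by
      intro k hk
      rcases Nat.eq_zero_or_eq_succ_pred k with h0 | h0
      · rw [h0, ← hclosed]
        have := h (u.length - 1) (by omega)
        rwa [show u.length - 1 + 1 = u.length by omega] at this
      · rw [h0]
        exact h _ (by omega)
    exact hk₁' ((h1 _ hk₁).trans (h1 0 (Nat.zero_le _)).symm)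
  have hcases : ∀ d v, v ≠ m r → LeavesAt u m d v → d = (⟨0, hr0⟩, true) ∨ d = z := by
    intro d v hv hd
    by_contra! h
    exact hv (hdir d v h.1 h.2 hd)
  -- Two distinct letters leave at this turn because the word is reduced, so they are x_1 and z.
  obtain ⟨hzne, hx0⟩ : z ≠ (⟨0, hr0⟩, true) ∧ LeavesAt u m (⟨0, hr0⟩, true) (m (k₂ + 1)) := by
    obtain ⟨h1, h2, h3⟩ := hturn k₂ (by simpa using hk₂)
    rcases hcases _ _ hk₂' h1 with h4 | h4 <;> rcases hcases _ _ hk₂' h2 with h5 | h5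
    · exact absurd (h4.trans h5.symm) h3
    · exact ⟨fun h => h3 (by rw [h4, h5, h]), h4 ▸ h1⟩
    · exact ⟨fun h => h3 (by rw [h4, h5, h]), h5 ▸ h2⟩
    · exact absurd (h4.trans h5.symm) h3
  have hx0' : ∀ v, LeavesAt u m (⟨0, hr0⟩, true) v → v ≠ m r := fun v hv => by
    rw [hz _ _ _ hzne.symm hv hx0]
    exact hk₂'
  have hchain : (u ++ [((⟨0, hr0⟩ : Fin r), true)]).IsChain (OnlyTurn (⟨0, hr0⟩ : Fin r) z) := by
    rw [List.isChain_iff_getElem]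
    intro k hk
    obtain ⟨h1, h2, h3⟩ := hturn k hk
    refine ⟨fun h => ?_, fun h => ?_⟩
    · refine (hcases _ _ (hx0' _ (h ▸ h1)) h2).resolve_left fun h4 => h3 (h.trans h4.symm)
    · refine (hcases _ _ (hx0' _ (h ▸ h2)) h1).resolve_left fun h4 => h3 (h4.trans h.symm)
  refine ⟨z, fun h => ?_, hchain⟩
  obtain rfl : z = (⟨0, hr0⟩, false) := by
    rcases z with ⟨j, _ | _⟩
    · exact Prod.ext h rfl
    · exact (hzne (Prod.ext h rfl)).elim
  exact not_isChain_onlyTurn_inv _ C (hchain.infix ⟨(⟨0, hr0⟩, true) :: t, [], by simp [hu, ht]⟩)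

/-- A cyclically reduced primitive word that contains the blocking word can be shortened. -/
theorem exists_shorter (hr0 : 0 < r)
    (hred : FreeGroup.IsReduced (shortBlockingWord hr0 ++ C ++ shortBlockingWord hr0))
    (hψ : FreeGroup.mk (shortBlockingWord hr0 ++ C) = ψ (.of ⟨0, hr0⟩)) :
    ∃ (D : List (Fin r × Bool)) (ψ' : MulAut (FreeGroup (Fin r))), D.length < C.length ∧
      FreeGroup.IsReduced (shortBlockingWord hr0 ++ D ++ shortBlockingWord hr0) ∧
      FreeGroup.mk (shortBlockingWord hr0 ++ D) = ψ' (.of ⟨0, hr0⟩) := by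
  obtain ⟨z, hz, hchain⟩ := exists_isChain_onlyTurn ψ hr0 hred hψ
  obtain ⟨t, ht, hw⟩ := shortBlockingWord_eq hr0
  set w := shortBlockingWord hr0
  set i : Fin r := ⟨0, hr0⟩
  have hzi : ∀ b, z ≠ (i, b) := by
    rintro b rfl
    exact hz rfl
  have hchain' : ((i, false) :: (C ++ [(i, true)])).IsChain (OnlyTurn i z) :=
    hchain.infix ⟨(i, true) :: t, [], by simp [hw]⟩
  -- C follows the last letter x_1⁻¹ of w and precedes the first letter x_1 of the next w, which
  -- forces its two ends.
  obtain ⟨C, rfl⟩ : ∃ C', C = z :: (C' ++ [invLetter z]) := by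
    rcases C with _ | ⟨a, C⟩
    · exact absurd ((List.isChain_cons_cons.1 hchain').1.1 rfl).symm (hzi _)
    rw [List.cons_append, List.isChain_cons_cons] at hchain'
    obtain rfl : a = z := hchain'.1.1 rfl
    rcases List.eq_nil_or_concat C with rfl | ⟨C', b, rfl⟩
    · exact absurd ((List.isChain_cons_cons.1 hchain'.2).1.2 rfl) (invLetter_ne _)
    · have h1 : [b, (i, true)].IsChain (OnlyTurn i a) :=
        hchain'.2.infix ⟨a :: C', [], by simp⟩
      rw [← (List.isChain_cons_cons.1 h1).1.2 rfl]
      exact ⟨C', by simp⟩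
  obtain ⟨D, hD, rfl⟩ := exists_flatMap_eq hz C
    (hchain'.infix ⟨[(i, false), z], [(i, true)], by simp⟩) (fun h => by
      obtain ⟨C', rfl⟩ := List.head?_eq_some_iff.1 h
      have h1 : [z, (i, true)].IsChain (OnlyTurn i z) :=
        hchain'.infix ⟨[(i, false)], C' ++ [invLetter z, (i, true)], by simp⟩
      exact invLetter_ne z ((List.isChain_cons_cons.1 h1).1.2 rfl))
  have hwflat : w.flatMap (leftMulBlock i z) = invLetter z :: w ++ [z] := by
    rw [hw, List.flatMap_append, List.flatMap_cons, flatMap_leftMulBlock_of_ne z ht]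
    simp [leftMulBlock]
  obtain ⟨φ, hφ⟩ := exists_mulAut_flatMap hz
  -- With C = zC'z⁻¹, the conjugate z⁻¹(wC)z equals (z⁻¹wz)C', the image of wD.
  refine ⟨D, φ⁻¹ * MulAut.conj (FreeGroup.mk [invLetter z]) * ψ, by
    simp only [List.length_cons, List.length_append]; omega, ?_, ?_⟩
  -- The image of wDw is z⁻¹(wCw)z, reduced because z does not involve x_1.
  · refine isReduced_of_flatMap_leftMulBlock (i := i) (z := z) ?_
    rw [List.flatMap_append, List.flatMap_append, hwflat]
    have h1 : ∀ a b : Fin r × Bool, a.1 ≠ b.1 → FreeGroup.IsReduced [a, b] := fun a b h =>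
      FreeGroup.isReduced_cons_cons.2 ⟨fun h' => absurd h' h, .singleton⟩
    have h2 := (h1 (invLetter z) (i, true) hz).append_overlap
      (L₃ := t ++ (i, false) :: z :: (D.flatMap (leftMulBlock i z) ++ invLetter z :: (i, true) :: t))
      (L₁ := [invLetter z]) (L₂ := [(i, true)]) (hred.infix ⟨[], [(i, false)], by simp [hw]⟩)
      (by simp)
    have h3 := FreeGroup.IsReduced.append_overlap (L₁ := invLetter z :: (i, true) :: t ++
      (i, false) :: z :: (D.flatMap (leftMulBlock i z) ++ invLetter z :: (i, true) :: t))
      (L₂ := [(i, false)]) (L₃ := [z]) ?_ (h1 (i, false) z (Ne.symm hz)) (by simp)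
    · simpa [hw] using h3
    · have h4 := FreeGroup.IsReduced.append_overlap (L₁ := [invLetter z]) (L₂ := [(i, true)])
        (L₃ := t ++ (i, false) :: z :: (D.flatMap (leftMulBlock i z) ++
          invLetter z :: (i, true) :: t) ++ [(i, false)])
        (h1 _ _ hz) (by simpa [hw] using hred) (by simp)
      simpa using h4
  · rw [MulAut.mul_apply, MulAut.mul_apply, ← hψ, MulAut.conj_apply, eq_comm, MulAut.inv_apply,
      MulEquiv.symm_apply_eq, hφ, List.flatMap_append, hwflat]
    have h1 : FreeGroup.mk [z] = (FreeGroup.mk [invLetter z])⁻¹ := by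
      simp [FreeGroup.inv_mk, FreeGroup.invRev, invLetter]
    have h2 : ∀ L : List (Fin r × Bool), FreeGroup.mk (z :: L) = .mk [z] * .mk L := fun L => by
      rw [FreeGroup.mul_mk, List.singleton_append]
    have h3 : ∀ L : List (Fin r × Bool), FreeGroup.mk (invLetter z :: L) =
        .mk [invLetter z] * .mk L := fun L => by
      rw [FreeGroup.mul_mk, List.singleton_append]
    simp only [List.cons_append, h3 (_ ++ _)]
    simp only [← FreeGroup.mul_mk, h2 (_ ++ _), h1]
    group

theorem isPrimitivityBlocking_shortBlockingWord (hr0 : 0 < r) :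
    IsPrimitivityBlocking hr0 (shortBlockingWord hr0) := by
  have key : ∀ (n : ℕ) (C : List (Fin r × Bool)) (ψ : MulAut (FreeGroup (Fin r))), C.length = n →
      FreeGroup.IsReduced (shortBlockingWord hr0 ++ C ++ shortBlockingWord hr0) →
      FreeGroup.mk (shortBlockingWord hr0 ++ C) ≠ ψ (.of ⟨0, hr0⟩) := by
    intro n
    induction n using Nat.strong_induction_on with
    | _ n ih =>
      rintro C ψ rfl hred hψ
      obtain ⟨D, ψ', hlt, hred', hψ'⟩ := exists_shorter ψ hr0 hred hψ
      exact ih _ hlt D ψ' rfl hred' hψ'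
  rintro φ ⟨A, B, h⟩
  set x := φ (.of ⟨0, hr0⟩) with hx
  have hcyc := FreeGroup.reduceCyclically.isCyclicallyReduced (FreeGroup.isReduced_toWord (x := x))
  have hconj := congrArg FreeGroup.mk
    (FreeGroup.reduceCyclically.conj_conjugator_reduceCyclically x.toWord)
  rw [← h] at hcyc hconj
  set g := FreeGroup.reduceCyclically.conjugator x.toWord
  -- The reduced square AwBAwB contains w(BA)w.
  have hsq := (hcyc.flatten_replicate 2).isReduced
  refine key _ (B ++ A) (MulAut.conj ((FreeGroup.mk A)⁻¹ * (FreeGroup.mk g)⁻¹) * φ) rfl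
    (hsq.infix ⟨A, B, by simp [List.replicate]⟩) ?_
  rw [MulAut.mul_apply, ← hx, MulAut.conj_apply, ← FreeGroup.mk_toWord (x := x), ← hconj]
  simp only [← FreeGroup.mul_mk, ← FreeGroup.inv_mk]
  group

end BlockingWord

theorem theorem4p3 (r : ℕ) (hr : 2 < r) :
    FreeGroup.IsReduced (shortBlockingWord (r := r) (by omega)) ∧
    (shortBlockingWord (r := r) (by omega)).length = 2 * r ∧
    IsPrimitivityBlocking (r := r) (by omega) (shortBlockingWord (by omega)) ∧
    ∀ v : List (Fin r × Bool), FreeGroup.IsReduced v → IsPrimitivityBlocking (by omega) v →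
      2 * r ≤ v.length := by
  refine ⟨isReduced_shortBlockingWord (by omega), length_shortBlockingWord _,
    isPrimitivityBlocking_shortBlockingWord _, fun v hv hblock => ?_⟩
  by_contra! h
  obtain ⟨φ, hφ⟩ := exists_infix_reduceCyclically (by simpa using hr) ⟨0, by omega⟩ hv
    (by simpa using h)
  exact hblock φ hφ
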